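/- Let $\mathcal A$ be an additive category, $\mathcal B$ an abelian category and $F:\mathcal A\to\mathcal B$ a (not necessarily additive) functor with $F(0)=0$. Let $n\ge 0$ be an integer. Notation. For $k\ge 0$ let $[k]=\{0<1<\dots<k\}$ and let $\mathrm{Sur}([n],[k])$ be the set of order-preserving surjections $[n]\to[k]$. For $\mu\in\mathrm{Sur}([n],[k])$ put $\mu^\triangle=\{\max\mu^{-1}(0),\dots,\max\mu^{-1}(k-1)\}\subseteq\{0,\dots,n-1\}$. A subset $\alpha\subseteq\coprod_{k=0}^n\mathrm{Sur}([n],[k])$ is called honourable if $\bigcup_{\mu\in\alpha}\mu^\triangle=\{0,1,\dots,n-1\}$. For a finite family $(A_j)_{j\in\iota}$ of objects of $\mathcal A$, let $\psi_j$ be the endomorphism of $\bigoplus_{j\in\iota}A_j$ that is the projection onto the $j$-th summand. The cross-effect $\mathrm{cr}_{|\iota|}(F)(A_j,\,j\in\iota)$ is the subobject $$\mathrm{Im}\Big(\sum_{\emptyset\ne J\subseteq\iota}(-1)^{|\iota|-|J|}F\big(\textstyle\sum_{j\in J}\psi_j\big)\Big)\subseteq F\Big(\bigoplus_{j\in\iota}A_j\Big);$$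 it is a functor of $(A_j)_{j\in\iota}$, a family of morphisms $(f_j)$ acting through $F(\bigoplus_j f_j)$. For a chain complex $C_\bullet$ in $\mathcal A$, concentrated in non-negative degrees, let $\Gamma(C_\bullet)$ be the simplicial object of the Dold–Kan correspondence, $\Gamma(C_\bullet)_n=\bigoplus_{k=0}^n\bigoplus_{\mu\in\mathrm{Sur}([n],[k])}C_k$, let $F\Gamma(C_\bullet)$ be the simplicial object of $\mathcal B$ obtained by applying $F$ degreewise, and for a simplicial object $X$ of $\mathcal B$ let $N(X)$ be the chain complex with $N(X)_n=X_n/\sum_{i=0}^{n-1}\mathrm{Im}(s_i)$, where the $s_i:X_{n-1}\to X_n$ are the degeneracy operators, and with differential induced by $\sum_i(-1)^i d_i$, where the $d_i$ are the face operators. For $\alpha\subseteq\coprod_{k=0}^n\mathrm{Sur}([n],[k])$ write $\alpha_k=\alpha\cap\mathrm{Sur}([n],[k])$ and $(C_{0,\alpha_0},\dots,C_{n,\alpha_n})$ for the family indexed by $\alpha$ whose entry at each $\mu\in\alpha_k$ is $C_k$. Statement. There is an isomorphism, natural in $C_\bullet$, $$NF\Gamma(C_\bullet)_n\;\cong\;\bigoplus_{\alpha\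 \text{honourable}}\mathrm{cr}_{|\alpha|}(F)(C_{0,\alpha_0},\dots,C_{n,\alpha_n}),$$ where the sum runs over all honourable subsets $\alpha$ of $\coprod_{k=0}^n\mathrm{Sur}([n],[k])$. It is canonical in the sense that the restriction of its inverse to the summand indexed by $\alpha$ is the composite $$\mathrm{cr}_{|\alpha|}(F)(C_{0,\alpha_0},\dots,C_{n,\alpha_n})\subseteq F\Big(\bigoplus_{k}\bigoplus_{\mu\in\alpha_k}C_k\Big)\longrightarrow F(\Gamma(C_\bullet)_n)\longrightarrow NF\Gamma(C_\bullet)_n$$ of the inclusion, the map induced by the inclusion of the subsum indexed by $\alpha$, and the canonical projection. -/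

import Mathlib

open CategoryTheory CategoryTheory.Limits Opposite

noncomputable section

namespace DoldPuppe

universe v₁ v₂ u₁ u₂

attribute [local instance] Abelian.hasFiniteBiproducts

section Normalization

variable {B : Type u₂} [Category.{v₂} B] [Abelian B]

/-- The degenerate part `∑_{i=0}^{n-1} Im(s_i)` of `X_n`, as a subobject of `X_n`
(the sum of a finite family of subobjects is their supremum); it is zero for `n = 0`. -/
def degenerate (X : SimplicialObject B) (n : ℕ) : Subobject (X.obj (op (SimplexCategory.mk n))) :=
  match n with
  | 0 => ⊥
  | n + 1 => Finset.univ.sup fun i : Fin (n + 1) => imageSubobject (X.σ i)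

theorem degenerate_succ_arrow_comp_eq_zero (X : SimplicialObject B) {n : ℕ} {Z : B}
    (f : X.obj (op (SimplexCategory.mk (n + 1))) ⟶ Z) (h : ∀ i : Fin (n + 1), X.σ i ≫ f = 0) :
    (degenerate X (n + 1)).arrow ≫ f = 0 := by
  have h1 : degenerate X (n + 1) ≤ kernelSubobject f := by
    refine Finset.sup_le fun i _ => ?_
    exact imageSubobject_le _ (factorThruKernelSubobject f (X.σ i) (h i)) (by simp)
  rw [← Subobject.ofLE_arrow h1, Category.assoc, kernelSubobject_arrow_comp, comp_zero]

theorem degenerate_zero_arrow_comp (X : SimplicialObject B) {Z : B}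
    (f : X.obj (op (SimplexCategory.mk 0)) ⟶ Z) : (degenerate X 0).arrow ≫ f = 0 := by
  have : (degenerate X 0).arrow = 0 := Subobject.bot_arrow
  rw [this, zero_comp]

/-- The object `N(X)_n = X_n / ∑_{i=0}^{n-1} Im(s_i)`. -/
def normalizedObj (X : SimplicialObject B) (n : ℕ) : B :=
  cokernel (degenerate X n).arrow

/-- The projection `X_n → N(X)_n`. -/
def normalizedProj (X : SimplicialObject B) (n : ℕ) :
    X.obj (op (SimplexCategory.mk n)) ⟶ normalizedObj X n :=
  cokernel.π (degenerate X n).arrow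

instance (X : SimplicialObject B) (n : ℕ) : Epi (normalizedProj X n) :=
  inferInstanceAs (Epi (coequalizer.π _ _))

theorem σ_comp_normalizedProj (X : SimplicialObject B) {n : ℕ} (i : Fin (n + 1)) :
    X.σ i ≫ normalizedProj X (n + 1) = 0 := by
  have h : imageSubobject (X.σ i) ≤ degenerate X (n + 1) :=
    Finset.le_sup (f := fun i : Fin (n + 1) => imageSubobject (X.σ i)) (Finset.mem_univ i)
  rw [← imageSubobject_arrow_comp (X.σ i), ← Subobject.ofLE_arrow h]
  have h0 : (degenerate X (n + 1)).arrow ≫ normalizedProj X (n + 1) = 0 := cokernel.condition _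
  rw [Category.assoc, Category.assoc, h0, comp_zero, comp_zero]

open AlgebraicTopology in
theorem σ_comp_objD_comp_normalizedProj (X : SimplicialObject B) (n : ℕ) (j : Fin (n + 1)) :
    X.σ j ≫ AlternatingFaceMapComplex.objD X n ≫ normalizedProj X n = 0 := by
  have key : ∀ i : Fin (n + 2), i ≠ j.castSucc → i ≠ j.succ →
      X.σ j ≫ X.δ i ≫ normalizedProj X n = 0 := by
    intro i h1 h2
    cases n with
    | zero => fin_cases i <;> fin_cases j <;> simp_all
    | succ m =>
      rcases lt_or_gt_of_ne h1 with h | h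
      · have hj : j ≠ 0 := by rintro rfl; simp at h
        have hi : i ≠ Fin.last _ := by rintro rfl; simp [Fin.lt_def] at h; omega
        obtain ⟨j, rfl⟩ := Fin.exists_succ_eq.2 hj
        obtain ⟨i, rfl⟩ := Fin.exists_castSucc_eq.2 hi
        rw [SimplicialObject.δ_comp_σ_of_le_assoc, σ_comp_normalizedProj, comp_zero]
        simp only [Fin.lt_def, Fin.le_def, Fin.val_castSucc, Fin.val_succ] at h ⊢
        omega
      · have h3 : j.succ < i := by
          refine lt_of_le_of_ne ?_ (Ne.symm h2)
          simp only [Fin.lt_def, Fin.le_def, Fin.val_castSucc, Fin.val_succ] at h ⊢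
          omega
        rw [SimplicialObject.δ_comp_σ_of_gt'_assoc X h3, σ_comp_normalizedProj, comp_zero]
  rw [AlternatingFaceMapComplex.objD, Preadditive.sum_comp, Preadditive.comp_sum,
    Finset.sum_eq_add_of_mem j.castSucc j.succ (Finset.mem_univ _) (Finset.mem_univ _)
      (ne_of_lt j.castSucc_lt_succ)]
  · simp [pow_succ, SimplicialObject.δ_comp_σ_self_assoc, SimplicialObject.δ_comp_σ_succ_assoc]
  · rintro i - ⟨h1, h2⟩
    simp [key i h1 h2]

/-- The differential of `N(X)`, induced by `∂ = ∑_{i=0}^{n+1} (-1)^i d_i : X_{n+1} → X_n`. -/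
def normalizedD (X : SimplicialObject B) (n : ℕ) :
    normalizedObj X (n + 1) ⟶ normalizedObj X n :=
  cokernel.desc _ (AlgebraicTopology.AlternatingFaceMapComplex.objD X n ≫ normalizedProj X n)
    (degenerate_succ_arrow_comp_eq_zero X _ (σ_comp_objD_comp_normalizedProj X n))

theorem normalizedProj_comp_normalizedD (X : SimplicialObject B) (n : ℕ) :
    normalizedProj X (n + 1) ≫ normalizedD X n =
      AlgebraicTopology.AlternatingFaceMapComplex.objD X n ≫ normalizedProj X n :=
  cokernel.π_desc _ _ _

/-- The map `N(X)_n → N(Y)_n` induced by a map of simplicial objects. -/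
def normalizedMap {X Y : SimplicialObject B} (f : X ⟶ Y) (n : ℕ) :
    normalizedObj X n ⟶ normalizedObj Y n :=
  cokernel.desc _ (f.app (op (SimplexCategory.mk n)) ≫ normalizedProj Y n) (by
    cases n with
    | zero => exact degenerate_zero_arrow_comp X _
    | succ n =>
      refine degenerate_succ_arrow_comp_eq_zero X _ fun i => ?_
      rw [SimplicialObject.σ_naturality_assoc, σ_comp_normalizedProj, comp_zero])

theorem normalizedProj_comp_normalizedMap {X Y : SimplicialObject B} (f : X ⟶ Y) (n : ℕ) :
    normalizedProj X n ≫ normalizedMap f n = f.app (op (SimplexCategory.mk n)) ≫ normalizedProj Y n :=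
  cokernel.π_desc _ _ _

/-- The normalized chain complex functor `N`, defined as the quotient of the alternating face map
complex by the degenerate part. -/
def N : SimplicialObject B ⥤ ChainComplex B ℕ where
  obj X := ChainComplex.of (normalizedObj X) (normalizedD X) (fun n => by
    rw [← cancel_epi (normalizedProj X (n + 2))]
    rw [← Category.assoc, normalizedProj_comp_normalizedD, Category.assoc,
      normalizedProj_comp_normalizedD, ← Category.assoc,
      AlgebraicTopology.AlternatingFaceMapComplex.d_squared, zero_comp, comp_zero])
  map {X Y} f := ChainComplex.ofHom (normalizedMap f) (fun n => by
    simp only [ChainComplex.of_d]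
    rw [← cancel_epi (normalizedProj X (n + 1))]
    have h := ((AlgebraicTopology.alternatingFaceMapComplex B).map f).comm (n + 1) n
    simp only [AlgebraicTopology.alternatingFaceMapComplex_obj_d,
      AlgebraicTopology.alternatingFaceMapComplex_map_f] at h
    rw [← Category.assoc, normalizedProj_comp_normalizedMap, Category.assoc,
      normalizedProj_comp_normalizedD, ← Category.assoc, ← Category.assoc,
      normalizedProj_comp_normalizedD,
      Category.assoc (AlgebraicTopology.AlternatingFaceMapComplex.objD X n),
      normalizedProj_comp_normalizedMap, ← Category.assoc]
    exact congrArg (fun t => t ≫ normalizedProj Y n) h)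
  map_id X := by
    ext n
    change normalizedMap (𝟙 X) n = 𝟙 (normalizedObj X n)
    rw [← cancel_epi (normalizedProj X n), normalizedProj_comp_normalizedMap]
    simp
  map_comp {X Y Z} f g := by
    ext n
    change normalizedMap (f ≫ g) n = normalizedMap f n ≫ normalizedMap g n
    rw [← cancel_epi (normalizedProj X n), ← Category.assoc (normalizedProj X n),
      normalizedProj_comp_normalizedMap, normalizedProj_comp_normalizedMap, Category.assoc,
      normalizedProj_comp_normalizedMap]
    simp

end Normalization

section CrossEffects

variable {A : Type u₁} [Category.{v₁} A] [Preadditive A]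
variable {B : Type u₂} [Category.{v₂} B] [Abelian B]

/-- The deviation `F(f_1 ⊤ ⋯ ⊤ f_m) = ∑_{∅ ≠ J ⊆ {1, …, m}} (-1)^{m - |J|} F(∑_{j ∈ J} f_j)` of a
finite family of parallel morphisms. -/
def deviation (F : A ⥤ B) {ι : Type*} [Fintype ι] {X Y : A} (f : ι → (X ⟶ Y)) :
    F.obj X ⟶ F.obj Y :=
  ∑ J : Finset ι with J.Nonempty,
    (-1 : ℤ) ^ (Fintype.card ι - J.card) • F.map (∑ j ∈ J, f j)

variable [HasFiniteBiproducts A]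

/-- The deviation `F(ψ_1 ⊤ ⋯ ⊤ ψ_m)` on `F(A_1 ⊕ ⋯ ⊕ A_m)`, where `ψ_j` is the projection of
`A_1 ⊕ ⋯ ⊕ A_m` onto its `j`-th summand, viewed as an endomorphism. -/
def crossDeviation (F : A ⥤ B) {ι : Type*} [Fintype ι] (X : ι → A) :
    F.obj (⨁ X) ⟶ F.obj (⨁ X) :=
  deviation F fun j => biproduct.π X j ≫ biproduct.ι X j

theorem crossDeviation_naturality (F : A ⥤ B) {ι : Type*} [Fintype ι] {X Y : ι → A}
    (f : ∀ j, X j ⟶ Y j) :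
    crossDeviation F X ≫ F.map (biproduct.map f) =
      F.map (biproduct.map f) ≫ crossDeviation F Y := by
  simp only [crossDeviation, deviation, Preadditive.sum_comp, Preadditive.comp_sum,
    Preadditive.zsmul_comp, Preadditive.comp_zsmul, ← F.map_comp]
  refine Finset.sum_congr rfl fun J _ => ?_
  congr 2
  exact Finset.sum_congr rfl fun j _ => by simp

/-- The map between the images of `F(ψ_1 ⊤ ⋯ ⊤ ψ_m)` that is induced by `F(f_1 ⊕ ⋯ ⊕ f_m)`. -/
def crossEffectMap (F : A ⥤ B) {ι : Type*} [Fintype ι] {X Y : ι → A} (f : ∀ j, X j ⟶ Y j) :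
    image (crossDeviation F X) ⟶ image (crossDeviation F Y) :=
  image.map (Arrow.homMk (F.map (biproduct.map f)) (F.map (biproduct.map f))
    (crossDeviation_naturality F f).symm : Arrow.mk (crossDeviation F X) ⟶
      Arrow.mk (crossDeviation F Y))

theorem crossEffectMap_ι (F : A ⥤ B) {ι : Type*} [Fintype ι] {X Y : ι → A}
    (f : ∀ j, X j ⟶ Y j) :
    crossEffectMap F f ≫ image.ι (crossDeviation F Y) =
      image.ι (crossDeviation F X) ≫ F.map (biproduct.map f) :=
  image.map_ι _

/-- The cross-effect functor `cr_{|ι|}(F) : A^ι ⥤ B` of `F`, for a finite index set `ι`. On objects,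
it is the image of `F(ψ_1 ⊤ ⋯ ⊤ ψ_m)` as a subobject of `F(A_1 ⊕ ⋯ ⊕ A_m)`; on morphisms it is induced
by `F(f_1 ⊕ ⋯ ⊕ f_m)`. -/
def crossEffect (F : A ⥤ B) (ι : Type*) [Fintype ι] : (ι → A) ⥤ B where
  obj X := image (crossDeviation F X)
  map {X Y} f := crossEffectMap F f
  map_id X := by
    rw [← cancel_mono (image.ι (crossDeviation F X)), crossEffectMap_ι]
    have : biproduct.map (𝟙 X : ∀ j, X j ⟶ X j) = 𝟙 (⨁ X) := by ext; simp
    rw [this]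
    simp
  map_comp {X Y Z} f g := by
    have : biproduct.map (f ≫ g : ∀ j, X j ⟶ Z j) = biproduct.map f ≫ biproduct.map g := by
      ext; simp
    rw [← cancel_mono (image.ι (crossDeviation F Z)), crossEffectMap_ι, Category.assoc,
      crossEffectMap_ι, ← Category.assoc, crossEffectMap_ι, this, F.map_comp, Category.assoc]

/-- The inclusion `cr_{|ι|}(F)(A_j, j ∈ ι) ⊆ F(⨁_{j ∈ ι} A_j)`. -/
def crossEffectι (F : A ⥤ B) {ι : Type*} [Fintype ι] (X : ι → A) :
    (crossEffect F ι).obj X ⟶ F.obj (⨁ X) :=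
  image.ι (crossDeviation F X)

end CrossEffects

section Honourable

/-- The disjoint union `⨿_{k=0}^n Sur([n],[k])` of the sets of order-preserving surjections:
its elements are pairs of an object `[k]` and an epimorphism `[n] ⟶ [k]` in the simplex
category. -/
abbrev Sur (n : ℕ) : Type := SimplicialObject.Splitting.IndexSet (op (SimplexCategory.mk n))

/-- The number `k` attached to a surjection `μ : [n] → [k]`. -/
abbrev Sur.target {n : ℕ} (μ : Sur n) : ℕ := μ.1.unop.len

/-- The order-preserving map `[n] → [k]` underlying an element of `Sur n`. -/
abbrev Sur.toFun {n : ℕ} (μ : Sur n) : Fin (n + 1) →o Fin (μ.target + 1) := μ.e.toOrderHom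

/-- The set `{max μ⁻¹(0), …, max μ⁻¹(k-1)}` attached to a surjection `μ : [n] → [k]`. -/
def Sur.triangle {n : ℕ} (μ : Sur n) : Set ℕ :=
  {i | ∃ j : Fin (μ.target + 1), (j : ℕ) < μ.target ∧
    ∃ x : Fin (n + 1), IsGreatest {y | μ.toFun y = j} x ∧ (x : ℕ) = i}

/-- A set `α` of surjections is honourable if the sets attached to its elements cover
`{0, …, n-1}` (and nothing else, which is automatic). -/
def Honourable {n : ℕ} (α : Finset (Sur n)) : Prop :=
  (⋃ μ ∈ α, μ.triangle) = {i : ℕ | i < n}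

end Honourable

section DoldPuppe

variable {A : Type u₁} [Category.{v₁} A] [Preadditive A] [HasFiniteBiproducts A]
variable {B : Type u₂} [Category.{v₂} B] [Abelian B]

/-- The functor `C ↦ N F Γ(C)`, where `F` is applied degreewise to simplicial objects and
`Γ(C)_n = ⨁_{k ≤ n} ⨁_{μ ∈ Sur([n],[k])} C_k`. -/
def doldPuppe (F : A ⥤ B) : ChainComplex A ℕ ⥤ ChainComplex B ℕ :=
  AlgebraicTopology.DoldKan.Γ₀ ⋙ (SimplicialObject.whiskering A B).obj F ⋙ N

/-- The functor `C ↦ (C_k)_{μ ∈ α, μ : [n] → [k]}`. -/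
def tuple {n : ℕ} (α : Finset (Sur n)) : ChainComplex A ℕ ⥤ (α → A) :=
  Functor.pi' fun μ => HomologicalComplex.eval A _ μ.1.target

/-- The functor sending `C` to the direct sum over all honourable `α` of the cross-effects
`cr_{|α|}(F)(C_{0,α_0}, …, C_{n,α_n})`. -/
def honourableSum (F : A ⥤ B) (n : ℕ) : ChainComplex A ℕ ⥤ B where
  obj C := ⨁ fun α : {α : Finset (Sur n) // Honourable α} =>
    (crossEffect F α.1).obj ((tuple α.1).obj C)
  map f := biproduct.map fun α => (crossEffect F α.1).map ((tuple α.1).map f)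
  map_id C := by
    apply biproduct.hom_ext'
    intro α
    simp
  map_comp f g := by
    apply biproduct.hom_ext'
    intro α
    simp

/-- The inclusion of the summand of `honourableSum F n` indexed by `α`. -/
def honourableSumι (F : A ⥤ B) {n : ℕ} (α : Finset (Sur n)) (hα : Honourable α)
    (C : ChainComplex A ℕ) :
    (crossEffect F α).obj ((tuple α).obj C) ⟶ (honourableSum F n).obj C :=
  biproduct.ι (fun α : {α : Finset (Sur n) // Honourable α} =>
    (crossEffect F α.1).obj ((tuple α.1).obj C)) ⟨α, hα⟩

/-- The canonical injection `⨁_{μ ∈ α} C_k → Γ(C)_n` of a subsum. -/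
def subsumι {n : ℕ} (α : Finset (Sur n)) (C : ChainComplex A ℕ) :
    ⨁ ((tuple α).obj C) ⟶ (AlgebraicTopology.DoldKan.Γ₀.obj C).obj (op (SimplexCategory.mk n)) :=
  biproduct.desc fun μ : α =>
    Sigma.ι (AlgebraicTopology.DoldKan.Γ₀.Obj.summand C (op (SimplexCategory.mk n))) μ.1

/-- The canonical projection `F(Γ(C)_n) → N F Γ(C)_n`. -/
def doldPuppeProj (F : A ⥤ B) (n : ℕ) (C : ChainComplex A ℕ) :
    F.obj ((AlgebraicTopology.DoldKan.Γ₀.obj C).obj (op (SimplexCategory.mk n))) ⟶ ((doldPuppe F).obj C).X n :=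
  normalizedProj (((SimplicialObject.whiskering A B).obj F).obj
    (AlgebraicTopology.DoldKan.Γ₀.obj C)) n

end DoldPuppe

end DoldPuppe

end

/-!
Write `Γ(C)_n` as the finite biproduct of the objects `C_k` over the set `S` of surjections
`μ : [n] → [k]`. For `J ⊆ S` let `E(J)` be `F` applied to the projection of `Γ(C)_n` onto the subsum
indexed by `J`. Then `E(T) E(U) = E(T ∩ U)`, so inclusion–exclusion shows that the alternating sums
`D(α) = ∑_{J ⊆ α} (-1)^{|α| - |J|} E(J)` are orthogonal idempotents with sum `E(S) = 1`
(`alternatingSum_mul_alternatingSum`, `sum_alternatingSum`). Because `F(0) = 0`, the term `J = ∅` is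
zero and `D(α)` is the deviation that cuts out the cross-effect of the subsum indexed by `α`; hence
`D(α)` splits through that cross-effect (`crossRetr_comp_crossIncl`, `crossIncl_comp_crossRetr`), and
`F(Γ(C)_n)` is the direct sum of the cross-effects of all `α ⊆ S`.

The degeneracy `s_i` maps `Γ(C)_{n-1}` isomorphically onto the subsum indexed by the set `T_i` of
those `μ` that factor through `σ i`, i.e. those with `i ∉ μ^△` (`gammaσ_comp_subsumProj`,
`exists_comp_gammaσ_eq_subsumProj`). So the image of `F(s_i)` is that of `E(T_i)`, and `E(T_i) D(α)`
is `D(α)` or `0` according as `α ⊆ T_i` or not. As `α` is honourable precisely when it is contained in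
no `T_i`, the degenerate part of `F(Γ(C)_n)` is the sum of the cross-effects that are not honourable,
and the honourable ones map isomorphically onto the quotient (`isIso_canonicalMap`).
-/

namespace DoldPuppe

universe v₁ v₂ u₁ u₂

attribute [local instance] Abelian.hasFiniteBiproducts

/-! ### Inclusion–exclusion for meet-multiplicative families -/

section InclusionExclusion

variable {S R : Type*} [Ring R]

/-- The alternating sum `∑_{J ⊆ α} (-1)^{|α| - |J|} E(J)`, i.e. the Möbius inverse of `E`. The
subtraction in the exponent does not truncate, as `J ⊆ α`. -/
def alternatingSum (E : Finset S → R) (α : Finset S) : R :=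
  ∑ J ∈ α.powerset, (-1 : ℤ) ^ (α.card - J.card) • E J

theorem alternatingSum_insert [DecidableEq S] (E : Finset S → R) {α : Finset S} {x : S}
    (hx : x ∉ α) :
    alternatingSum E (insert x α) =
      alternatingSum (fun J => E (insert x J)) α - alternatingSum E α := by
  unfold alternatingSum
  rw [Finset.sum_powerset_insert hx, add_comm, sub_eq_add_neg, ← Finset.sum_neg_distrib]
  congr 1
  · refine Finset.sum_congr rfl fun J hJ => ?_
    rw [Finset.card_insert_of_notMem hx,
      Finset.card_insert_of_notMem fun h => hx (Finset.mem_powerset.1 hJ h), Nat.add_sub_add_right]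
  · refine Finset.sum_congr rfl fun J hJ => ?_
    rw [Finset.card_insert_of_notMem hx,
      Nat.sub_add_comm (Finset.card_le_card (Finset.mem_powerset.1 hJ)), pow_succ]
    simp

/-- Möbius inversion on the lattice of finite subsets. -/
theorem sum_alternatingSum [DecidableEq S] (E : Finset S → R) (s : Finset S) :
    ∑ α ∈ s.powerset, alternatingSum E α = E s := by
  induction s using Finset.induction_on generalizing E with
  | empty => simp [alternatingSum]
  | insert x s hx ih =>
    rw [Finset.sum_powerset_insert hx, ← ih fun J => E (insert x J), ← Finset.sum_add_distrib]
    refine Finset.sum_congr rfl fun α hα => ?_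
    rw [alternatingSum_insert E fun h => hx (Finset.mem_powerset.1 hα h)]
    abel

variable [DecidableEq S] {E : Finset S → R} (hE : ∀ T U, E T * E U = E (T ∩ U))
include hE

/-- If `x ∈ α` is not in `T`, the terms of `J` and `J ∪ {x}` cancel. -/
theorem mul_alternatingSum (T α : Finset S) :
    E T * alternatingSum E α = if α ⊆ T then alternatingSum E α else 0 := by
  have h : E T * alternatingSum E α = alternatingSum (fun J => E (T ∩ J)) α := by
    simp only [alternatingSum, Finset.mul_sum, mul_smul_comm, hE]
  rw [h]
  split_ifs with hα
  · refine Finset.sum_congr rfl fun J hJ => ?_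
    simp only [Finset.inter_eq_right.2 ((Finset.mem_powerset.1 hJ).trans hα)]
  · obtain ⟨x, hx, hxT⟩ := Finset.not_subset.1 hα
    rw [← Finset.insert_erase hx, alternatingSum_insert _ (Finset.notMem_erase x α)]
    simp only [Finset.inter_insert_of_notMem hxT, sub_self]

theorem alternatingSum_mul (T α : Finset S) :
    alternatingSum E α * E T = if α ⊆ T then alternatingSum E α else 0 := by
  rw [← mul_alternatingSum hE T α]
  simp only [alternatingSum, Finset.mul_sum, Finset.sum_mul, mul_smul_comm, smul_mul_assoc, hE,
    Finset.inter_comm T]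

/-- The Möbius inverse of a meet-multiplicative family consists of orthogonal idempotents. -/
theorem alternatingSum_mul_alternatingSum (α β : Finset S) :
    alternatingSum E α * alternatingSum E β = if α = β then alternatingSum E α else 0 := by
  by_cases h : β ⊆ α
  -- If `β ⊆ α`, then only the term `J = β` of the right factor can satisfy `α ⊆ J`, and then `α = β`.
  · have key : alternatingSum E α * alternatingSum E β =
        ∑ J ∈ β.powerset,
          (-1 : ℤ) ^ (β.card - J.card) • if α ⊆ J then alternatingSum E α else 0 := by
      conv_lhs => enter [2]; unfold alternatingSum
      simp only [Finset.mul_sum, mul_smul_comm, alternatingSum_mul hE]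
    rw [key, Finset.sum_eq_single β]
    · have : α ⊆ β ↔ α = β := ⟨fun h' => h'.antisymm h, fun h' => h'.subset⟩
      simp [this]
    · intro J hJ hne
      rw [if_neg, smul_zero]
      exact fun h' => hne ((Finset.mem_powerset.1 hJ).antisymm (h.trans h'))
    · simp
  · rw [if_neg fun e => h e.symm.subset]
    conv_lhs => enter [1]; unfold alternatingSum
    simp only [Finset.sum_mul, smul_mul_assoc, mul_alternatingSum hE]
    refine Finset.sum_eq_zero fun J hJ => ?_
    rw [if_neg fun h' => h (h'.trans (Finset.mem_powerset.1 hJ)), smul_zero]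

end InclusionExclusion

/-! ### Cross-effects of the subsums of a bicone -/

section ToCrossEffect

variable {A : Type u₁} [Category.{v₁} A] [Preadditive A] [HasFiniteBiproducts A]
variable {B : Type u₂} [Category.{v₂} B] [Abelian B]
variable (F : A ⥤ B) {ι : Type*} [Fintype ι] (X : ι → A)

/-- The corestriction of the deviation to its image, the cross-effect. -/
noncomputable def toCrossEffect : F.obj (⨁ X) ⟶ (crossEffect F ι).obj X :=
  factorThruImage (crossDeviation F X)

theorem toCrossEffect_comp_crossEffectι :
    toCrossEffect F X ≫ crossEffectι F X = crossDeviation F X :=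
  image.fac _

instance : Epi (toCrossEffect F X) :=
  inferInstanceAs (Epi (factorThruImage (crossDeviation F X)))

instance : Mono (crossEffectι F X) :=
  inferInstanceAs (Mono (image.ι (crossDeviation F X)))

end ToCrossEffect

section Bicone

variable {A : Type u₁} [Category.{v₁} A] [Preadditive A]
variable {B : Type u₂} [Category.{v₂} B] [Abelian B]
variable {S : Type} {X : S → A} (b : Bicone X)

/-- The endomorphism of (the apex of) a bicone that projects onto the subsum indexed by `J`. -/
def subsumProj (J : Finset S) : b.pt ⟶ b.pt :=
  ∑ j ∈ J, b.π j ≫ b.ι j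

theorem ι_comp_subsumProj {J : Finset S} {j : S} (hj : j ∈ J) : b.ι j ≫ subsumProj b J = b.ι j := by
  rw [subsumProj, Preadditive.comp_sum, Finset.sum_eq_single_of_mem j hj]
  · simp
  · intro k _ hk
    rw [bicone_ι_π_ne_assoc b hk.symm, zero_comp]

theorem ι_comp_subsumProj_eq_zero {J : Finset S} {j : S} (hj : j ∉ J) :
    b.ι j ≫ subsumProj b J = 0 := by
  rw [subsumProj, Preadditive.comp_sum]
  refine Finset.sum_eq_zero fun k hk => ?_
  rw [bicone_ι_π_ne_assoc b (ne_of_mem_of_not_mem hk hj).symm, zero_comp]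

theorem subsumProj_comp_subsumProj [DecidableEq S] (T U : Finset S) :
    subsumProj b T ≫ subsumProj b U = subsumProj b (T ∩ U) := by
  rw [subsumProj.eq_def b T, Preadditive.sum_comp, ← Finset.filter_mem_eq_inter,
    subsumProj.eq_def b (Finset.filter _ _), Finset.sum_filter]
  refine Finset.sum_congr rfl fun j _ => ?_
  split_ifs with h
  · rw [Category.assoc, ι_comp_subsumProj b h]
  · rw [Category.assoc, ι_comp_subsumProj_eq_zero b h, comp_zero]

/-- The endomorphism of `F` of a bicone induced by the projection onto the subsum indexed by `J`. -/
def subsumEnd (F : A ⥤ B) (J : Finset S) : End (F.obj b.pt) :=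
  F.map (subsumProj b J)

omit [Abelian B] in
theorem subsumEnd_mul_subsumEnd [DecidableEq S] (F : A ⥤ B) (T U : Finset S) :
    subsumEnd b F T * subsumEnd b F U = subsumEnd b F (T ∩ U) := by
  rw [End.mul_def, subsumEnd, subsumEnd, ← F.map_comp, subsumProj_comp_subsumProj,
    Finset.inter_comm, subsumEnd]

variable [HasFiniteBiproducts A]

/-- The inclusion of the subsum indexed by `α`. -/
noncomputable def subsumIncl (α : Finset S) : ⨁ (fun j : α => X j) ⟶ b.pt :=
  biproduct.desc fun j => b.ι j

/-- The retraction onto the subsum indexed by `α`. -/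
noncomputable def subsumRetr (α : Finset S) : b.pt ⟶ ⨁ (fun j : α => X j) :=
  biproduct.lift fun j => b.π j

theorem subsumIncl_comp_subsumRetr (α : Finset S) : subsumIncl b α ≫ subsumRetr b α = 𝟙 _ := by
  refine biproduct.hom_ext' _ _ fun j => biproduct.hom_ext _ _ fun k => ?_
  by_cases h : j = k
  · subst h
    simp [subsumIncl, subsumRetr]
  · have h' : (j : S) ≠ k := fun e => h (Subtype.ext e)
    simp [subsumIncl, subsumRetr, bicone_ι_π_ne b h', biproduct.ι_π_ne _ h]

/-- The zero morphism factors through the empty biproduct, which `F` sends to a zero object. -/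
theorem map_zero_of_isZero {F : A ⥤ B} (hF : ∀ Z : A, IsZero Z → IsZero (F.obj Z)) (Y Z : A) :
    F.map (0 : Y ⟶ Z) = 0 := by
  have h : (0 : Y ⟶ Z) = (0 : Y ⟶ ⨁ (fun j : Fin 0 => j.elim0)) ≫ 0 := by simp
  rw [h, F.map_comp, (hF _ ((IsZero.iff_id_eq_zero _).2 (by ext j; exact j.elim0))).eq_zero_of_tgt
    (F.map _), zero_comp]

/-- The endomorphism of `F` of the whole sum that cuts out the cross-effect of the subsum
indexed by `α`. The empty `J`, which the deviation omits, does not contribute as `F(0) = 0`. -/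
theorem subsumRetr_comp_crossDeviation_comp_subsumIncl {F : A ⥤ B}
    (hF : ∀ Z : A, IsZero Z → IsZero (F.obj Z)) (α : Finset S) :
    F.map (subsumRetr b α) ≫ crossDeviation F (fun j : α => X j) ≫ F.map (subsumIncl b α) =
      alternatingSum (subsumEnd b F) α := by
  classical
  have h1 : ∀ J : Finset α, subsumRetr b α ≫
      (∑ j ∈ J, biproduct.π (fun j : α => X j) j ≫ biproduct.ι (fun j : α => X j) j) ≫
        subsumIncl b α = subsumProj b (J.map (Function.Embedding.subtype _)) := by
    intro J
    rw [subsumProj, Finset.sum_map, Preadditive.sum_comp, Preadditive.comp_sum]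
    refine Finset.sum_congr rfl fun j _ => ?_
    simp [subsumRetr, subsumIncl]
  simp only [crossDeviation, deviation, Preadditive.sum_comp, Preadditive.comp_sum,
    Preadditive.zsmul_comp, Preadditive.comp_zsmul]
  simp only [← F.map_comp, h1]
  rw [Finset.sum_filter_of_ne, alternatingSum]
  · refine Finset.sum_bij (fun J _ => J.map (Function.Embedding.subtype _)) ?_ ?_ ?_ ?_
    · intro J _
      rw [Finset.mem_powerset]
      exact Finset.map_subtype_subset J
    · intro J _ J' _ h
      exact Finset.map_injective _ h
    · intro J hJ
      exact ⟨J.subtype _, Finset.mem_univ _,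
        Finset.subtype_map_of_mem fun x hx => Finset.mem_powerset.1 hJ hx⟩
    · intro J _
      rw [Finset.card_map, Fintype.card_coe]
      rfl
  · intro J _ hJ
    by_contra h
    rw [Finset.not_nonempty_iff_eq_empty] at h
    subst h
    exact hJ (by simp [subsumProj, map_zero_of_isZero hF])

variable (F : A ⥤ B)

/-- The inclusion of the cross-effect of the subsum indexed by `α` into `F` of the whole sum. -/
noncomputable def crossIncl (α : Finset S) :
    (crossEffect F α).obj (fun j : α => X j) ⟶ F.obj b.pt :=
  crossEffectι F (fun j : α => X j) ≫ F.map (subsumIncl b α)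

/-- The retraction of `F` of the whole sum onto the cross-effect of the subsum indexed by `α`. -/
noncomputable def crossRetr (α : Finset S) :
    F.obj b.pt ⟶ (crossEffect F α).obj (fun j : α => X j) :=
  F.map (subsumRetr b α) ≫ toCrossEffect F (fun j : α => X j)

variable {F} (hF : ∀ Z : A, IsZero Z → IsZero (F.obj Z))
include hF

theorem crossRetr_comp_crossIncl (α : Finset S) :
    crossRetr b F α ≫ crossIncl b F α = alternatingSum (subsumEnd b F) α := by
  rw [← subsumRetr_comp_crossDeviation_comp_subsumIncl b hF, crossRetr, crossIncl, Category.assoc,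
    ← toCrossEffect_comp_crossEffectι, Category.assoc]

/-- Both sides may be compared after composing with the epimorphism `crossRetr` and the
monomorphism `crossIncl`, where the claim says that the deviations are orthogonal idempotents. -/
theorem crossIncl_comp_crossRetr [DecidableEq S] (α β : Finset S) :
    crossIncl b F α ≫ crossRetr b F β =
      if h : α = β then eqToHom (by subst h; rfl) else 0 := by
  have e (α : Finset S) : F.map (subsumIncl b α) ≫ F.map (subsumRetr b α) = 𝟙 _ := by
    rw [← F.map_comp, subsumIncl_comp_subsumRetr, F.map_id]
  have : Epi (crossRetr b F α) := by
    have : IsSplitEpi (F.map (subsumRetr b α)) := ⟨⟨⟨_, e α⟩⟩⟩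
    unfold crossRetr
    exact epi_comp _ _
  have : Mono (crossIncl b F β) := by
    have : IsSplitMono (F.map (subsumIncl b β)) := ⟨⟨⟨_, e β⟩⟩⟩
    unfold crossIncl
    exact mono_comp _ _
  rw [← cancel_epi (crossRetr b F α), ← cancel_mono (crossIncl b F β), Category.assoc,
    Category.assoc, crossRetr_comp_crossIncl b hF, ← Category.assoc,
    crossRetr_comp_crossIncl b hF, ← End.mul_def,
    alternatingSum_mul_alternatingSum (subsumEnd_mul_subsumEnd b F)]
  by_cases h : α = β
  · subst h
    simp [crossRetr_comp_crossIncl b hF]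
  · simp [h, Ne.symm h]

end Bicone

/-! ### Honourable sets of surjections -/

section Honourable

/-- For a surjection `μ` onto `[k]`, the number `i` is the maximum of a fibre of `μ` other than the
last one precisely when `μ` jumps between `i` and `i + 1`. -/
theorem Sur.mem_triangle_iff {n : ℕ} (μ : Sur n) (i : ℕ) :
    i ∈ μ.triangle ↔ ∃ j : Fin n, (j : ℕ) = i ∧ μ.toFun j.castSucc ≠ μ.toFun j.succ := by
  have hsurj : Function.Surjective μ.toFun := SimplexCategory.epi_iff_surjective.1 inferInstance
  constructor
  · rintro ⟨j, hj, x, ⟨hx, hmax⟩, rfl⟩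
    have hx' : μ.toFun x = j := hx
    have hxn : (x : ℕ) < n := by
      by_contra h
      obtain ⟨y, hy⟩ := hsurj (Fin.last _)
      have hyx : y ≤ x := by
        rw [Fin.le_def]
        have := y.isLt
        omega
      have := μ.toFun.monotone hyx
      rw [hy, hx', Fin.le_def, Fin.val_last] at this
      omega
    refine ⟨⟨x, hxn⟩, rfl, fun h => ?_⟩
    have h1 : Fin.succ (⟨x, hxn⟩ : Fin n) ≤ x := hmax (h.symm.trans hx')
    rw [Fin.le_def, Fin.val_succ] at h1
    simp at h1
  · rintro ⟨j, rfl, hj⟩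
    have hlt : μ.toFun j.castSucc < μ.toFun j.succ :=
      lt_of_le_of_ne (μ.toFun.monotone j.castSucc_lt_succ.le) hj
    refine ⟨μ.toFun j.castSucc, ?_, j.castSucc, ⟨rfl, fun y hy => ?_⟩, rfl⟩
    · have := (μ.toFun j.succ).isLt
      rw [Fin.lt_def] at hlt
      omega
    · by_contra h
      have hle : j.succ ≤ y := Fin.castSucc_lt_iff_succ_le.1 (not_le.1 h)
      have := μ.toFun.monotone hle
      rw [show μ.toFun y = μ.toFun j.castSucc from hy] at this
      exact absurd hlt this.not_gt

theorem honourable_iff {n : ℕ} (α : Finset (Sur n)) :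
    Honourable α ↔ ∀ i : Fin n, ∃ μ ∈ α, μ.toFun i.castSucc ≠ μ.toFun i.succ := by
  simp only [Honourable, Set.ext_iff, Set.mem_iUnion, Set.mem_ofPred_eq, Sur.mem_triangle_iff,
    exists_prop]
  constructor
  · intro h i
    obtain ⟨μ, hμ, j, hj, hne⟩ := (h i).2 i.isLt
    obtain rfl : j = i := Fin.ext hj
    exact ⟨μ, hμ, hne⟩
  · refine fun h x => ⟨fun ⟨μ, _, j, hj, _⟩ => hj ▸ j.isLt, fun hx => ?_⟩
    obtain ⟨μ, hμ, hne⟩ := h ⟨x, hx⟩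
    exact ⟨μ, hμ, ⟨x, hx⟩, rfl, hne⟩

/-- The surjections `[n+1] → [k]` that identify `i` and `i + 1`, i.e. that factor through the
degeneracy `σ i`. -/
noncomputable def degenerateSur {n : ℕ} (i : Fin (n + 1)) : Finset (Sur (n + 1)) :=
  open Classical in Finset.univ.filter fun μ => μ.toFun i.castSucc = μ.toFun i.succ

theorem mem_degenerateSur {n : ℕ} {i : Fin (n + 1)} {μ : Sur (n + 1)} :
    μ ∈ degenerateSur i ↔ μ.toFun i.castSucc = μ.toFun i.succ := by
  simp [degenerateSur]

theorem honourable_succ_iff {n : ℕ} (α : Finset (Sur (n + 1))) :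
    Honourable α ↔ ∀ i : Fin (n + 1), ¬ α ⊆ degenerateSur i := by
  simp only [honourable_iff, Finset.not_subset, mem_degenerateSur]

/-- The surjection `σ i ≫ μ`. -/
def Sur.degenerate {n : ℕ} (i : Fin (n + 1)) (μ : Sur n) : Sur (n + 1) :=
  SimplicialObject.Splitting.IndexSet.mk (SimplexCategory.σ i ≫ μ.e)

theorem Sur.degenerate_mem_degenerateSur {n : ℕ} (i : Fin (n + 1)) (μ : Sur n) :
    μ.degenerate i ∈ degenerateSur i := by
  rw [mem_degenerateSur]
  have h : i.predAbove i.castSucc = i.predAbove i.succ := by simp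
  exact congrArg μ.e.toOrderHom h

theorem exists_degenerate_eq {n : ℕ} {i : Fin (n + 1)} {μ : Sur (n + 1)}
    (hμ : μ ∈ degenerateSur i) : ∃ ν : Sur n, ν.degenerate i = μ := by
  obtain ⟨⟨Δ⟩, θ, hθ⟩ := μ
  obtain ⟨θ', h⟩ := SimplexCategory.eq_σ_comp_of_not_injective' θ i (mem_degenerateSur.1 hμ)
  dsimp at θ h
  subst h
  have : Epi θ' := epi_of_epi (SimplexCategory.σ i) θ'
  exact ⟨SimplicialObject.Splitting.IndexSet.mk θ', rfl⟩

end Honourable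

/-! ### The degenerate part of `F(Γ(C)_n)` -/

section Gamma

variable {A : Type u₁} [Category.{v₁} A] [Preadditive A] [HasFiniteBiproducts A]

/-- The decomposition of `Γ(C)_n` as a biproduct indexed by the surjections out of `[n]`. Its apex
is definitionally `Γ(C)_n`. -/
noncomputable def gammaBicone (C : ChainComplex A ℕ) (n : ℕ) :
    Bicone fun μ : Sur n => C.X μ.target :=
  Bicone.ofColimitCocone (coproductIsCoproduct
    (AlgebraicTopology.DoldKan.Γ₀.Obj.summand C (op (SimplexCategory.mk n))))

theorem gammaBicone_hom_ext {C : ChainComplex A ℕ} {n : ℕ} {Z : A}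
    {f g : (gammaBicone C n).pt ⟶ Z}
    (h : ∀ μ, (gammaBicone C n).ι μ ≫ f = (gammaBicone C n).ι μ ≫ g) : f = g :=
  Sigma.hom_ext (f := AlgebraicTopology.DoldKan.Γ₀.Obj.summand C (op (SimplexCategory.mk n))) _ _ h

theorem subsumProj_univ (C : ChainComplex A ℕ) (n : ℕ) :
    subsumProj (gammaBicone C n) Finset.univ = 𝟙 _ :=
  gammaBicone_hom_ext fun μ => by
    rw [ι_comp_subsumProj _ (Finset.mem_univ μ), Category.comp_id]

/-- The degeneracy `s_i` of `Γ(C)`, between the apices of the decompositions. -/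
noncomputable def gammaσ (C : ChainComplex A ℕ) {n : ℕ} (i : Fin (n + 1)) :
    (gammaBicone C n).pt ⟶ (gammaBicone C (n + 1)).pt :=
  (AlgebraicTopology.DoldKan.Γ₀.obj C).σ i

/-- The degeneracy `s_i` carries the summand `ν` of `Γ(C)_n` identically onto the summand
`σ i ≫ ν` of `Γ(C)_{n+1}`. -/
theorem gammaBicone_ι_comp_gammaσ (C : ChainComplex A ℕ) {n : ℕ} (i : Fin (n + 1)) (ν : Sur n) :
    (gammaBicone C n).ι ν ≫ gammaσ C i = (gammaBicone C (n + 1)).ι (ν.degenerate i) := by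
  refine (AlgebraicTopology.DoldKan.Γ₀.Obj.map_on_summand₀ C ν
    (θ := (SimplexCategory.σ i).op) (e := SimplexCategory.σ i ≫ ν.e) (i := 𝟙 _)
    (Category.comp_id _)).trans ?_
  rw [AlgebraicTopology.DoldKan.Γ₀.Obj.Termwise.mapMono_id]
  exact Category.id_comp _

theorem gammaσ_comp_subsumProj (C : ChainComplex A ℕ) {n : ℕ} (i : Fin (n + 1)) :
    gammaσ C i ≫ subsumProj (gammaBicone C (n + 1)) (degenerateSur i) = gammaσ C i := by
  refine gammaBicone_hom_ext fun ν => ?_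
  rw [← Category.assoc, gammaBicone_ι_comp_gammaσ]
  exact ι_comp_subsumProj _ (ν.degenerate_mem_degenerateSur i)

/-- The projection onto the subsum of the surjections that factor through `σ i` factors through
`s_i`. -/
theorem exists_comp_gammaσ_eq_subsumProj (C : ChainComplex A ℕ) {n : ℕ} (i : Fin (n + 1)) :
    ∃ r, r ≫ gammaσ C i = subsumProj (gammaBicone C (n + 1)) (degenerateSur i) := by
  have h : ∀ μ ∈ degenerateSur i, ∃ g, g ≫ gammaσ C i = (gammaBicone C (n + 1)).ι μ := by
    intro μ hμ
    obtain ⟨ν, rfl⟩ := exists_degenerate_eq hμ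
    exact ⟨(gammaBicone C n).ι ν, gammaBicone_ι_comp_gammaσ C i ν⟩
  choose! g hg using h
  refine ⟨∑ μ ∈ degenerateSur i, (gammaBicone C (n + 1)).π μ ≫ g μ, ?_⟩
  rw [Preadditive.sum_comp, subsumProj]
  refine Finset.sum_congr rfl fun μ hμ => ?_
  rw [Category.assoc, hg μ hμ]

variable {B : Type u₂} [Category.{v₂} B] [Abelian B] (F : A ⥤ B)

/-- The projection `F(Γ(C)_n) → NFΓ(C)_n`, out of `F` of the apex of the decomposition. -/
noncomputable def gammaProj (C : ChainComplex A ℕ) (n : ℕ) :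
    F.obj (gammaBicone C n).pt ⟶ ((doldPuppe F).obj C).X n :=
  doldPuppeProj F n C

instance (C : ChainComplex A ℕ) (n : ℕ) : Epi (gammaProj F C n) :=
  inferInstanceAs (Epi (normalizedProj _ n))

theorem map_gammaσ_comp_gammaProj (C : ChainComplex A ℕ) {n : ℕ} (i : Fin (n + 1)) :
    F.map (gammaσ C i) ≫ gammaProj F C (n + 1) = 0 :=
  σ_comp_normalizedProj (((SimplicialObject.whiskering A B).obj F).obj
    (AlgebraicTopology.DoldKan.Γ₀.obj C)) i

/-- The idempotent of `F(Γ(C)_n)` that projects onto the cross-effect indexed by `α`. -/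
noncomputable def crossIdem (C : ChainComplex A ℕ) {n : ℕ} (α : Finset (Sur n)) :
    End (F.obj (gammaBicone C n).pt) :=
  alternatingSum (subsumEnd (gammaBicone C n) F) α

theorem sum_crossIdem (C : ChainComplex A ℕ) (n : ℕ) :
    ∑ α : Finset (Sur n), crossIdem F C α = 1 := by
  classical
  have h := sum_alternatingSum (subsumEnd (gammaBicone C n) F) Finset.univ
  rw [Finset.powerset_univ, subsumEnd, subsumProj_univ, F.map_id] at h
  exact h

/-- Composed with the idempotent of an honourable set, every degeneracy vanishes. -/
theorem map_gammaσ_comp_crossIdem (C : ChainComplex A ℕ) {n : ℕ} (i : Fin (n + 1))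
    {α : Finset (Sur (n + 1))} (hα : Honourable α) :
    F.map (gammaσ C i) ≫ crossIdem F C α = 0 := by
  classical
  have h := alternatingSum_mul (subsumEnd_mul_subsumEnd (gammaBicone C (n + 1)) F)
    (degenerateSur i) α
  rw [if_neg ((honourable_succ_iff α).1 hα i), End.mul_def] at h
  rw [← gammaσ_comp_subsumProj C i, F.map_comp, Category.assoc]
  exact (congrArg (F.map (gammaσ C i) ≫ ·) h).trans comp_zero

/-- A cross-effect that is not honourable lies in the image of some degeneracy. -/
theorem crossIdem_comp_gammaProj_eq_zero (C : ChainComplex A ℕ) {n : ℕ} {α : Finset (Sur n)}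
    (hα : ¬ Honourable α) : crossIdem F C α ≫ gammaProj F C n = 0 := by
  classical
  cases n with
  -- For `n = 0` every set of surjections is honourable.
  | zero => exact absurd ((honourable_iff α).2 fun i => i.elim0) hα
  | succ n =>
    rw [honourable_succ_iff] at hα
    push Not at hα
    obtain ⟨i, hi⟩ := hα
    obtain ⟨r, hr⟩ := exists_comp_gammaσ_eq_subsumProj C i
    have h := mul_alternatingSum (subsumEnd_mul_subsumEnd (gammaBicone C (n + 1)) F)
      (degenerateSur i) α
    rw [if_pos hi, End.mul_def, subsumEnd, ← hr, F.map_comp] at h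
    rw [crossIdem, ← h, Category.assoc, Category.assoc, map_gammaσ_comp_gammaProj, comp_zero,
      comp_zero]

/-- Modulo the degenerate part, only the honourable cross-effects contribute to the decomposition of
the identity. -/
theorem sum_honourable_crossIdem_comp_gammaProj (C : ChainComplex A ℕ) (n : ℕ)
    [Fintype {α : Finset (Sur n) // Honourable α}] :
    ∑ α : {α : Finset (Sur n) // Honourable α}, crossIdem F C α.1 ≫ gammaProj F C n =
      gammaProj F C n := by
  classical
  have h : (∑ α : Finset (Sur n), crossIdem F C α) ≫ gammaProj F C n = gammaProj F C n := by
    rw [sum_crossIdem]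
    exact Category.id_comp _
  rw [Preadditive.sum_comp, ← Finset.sum_filter_of_ne (p := Honourable)] at h
  · rw [← h]
    symm
    convert! Finset.sum_subtype _ (fun α => ?_) _
    simp
  · intro α _ hne
    by_contra hα
    exact hne (crossIdem_comp_gammaProj_eq_zero F C hα)

/-! ### The decomposition of `NFΓ(C)_n` -/

variable {F}

theorem crossRetr_comp_crossIncl_gamma (hF : ∀ Z : A, IsZero Z → IsZero (F.obj Z))
    (C : ChainComplex A ℕ) {n : ℕ} (α : Finset (Sur n)) :
    crossRetr (gammaBicone C n) F α ≫ crossIncl (gammaBicone C n) F α = crossIdem F C α :=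
  crossRetr_comp_crossIncl _ hF α

theorem map_gammaσ_comp_crossRetr (hF : ∀ Z : A, IsZero Z → IsZero (F.obj Z))
    (C : ChainComplex A ℕ) {n : ℕ} (i : Fin (n + 1))
    {α : Finset (Sur (n + 1))} (hα : Honourable α) :
    F.map (gammaσ C i) ≫ crossRetr (gammaBicone C (n + 1)) F α = 0 := by
  classical
  have h : crossRetr (gammaBicone C (n + 1)) F α =
      crossIdem F C α ≫ crossRetr (gammaBicone C (n + 1)) F α := by
    rw [← crossRetr_comp_crossIncl_gamma hF, Category.assoc, crossIncl_comp_crossRetr _ hF]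
    simp
  rw [h, ← Category.assoc, map_gammaσ_comp_crossIdem F C i hα, zero_comp]

/-- The retraction of `NFΓ(C)_n` onto an honourable cross-effect. -/
theorem exists_gammaProj_comp_eq_crossRetr (hF : ∀ Z : A, IsZero Z → IsZero (F.obj Z))
    (C : ChainComplex A ℕ) {n : ℕ} {α : Finset (Sur n)} (hα : Honourable α) :
    ∃ q, gammaProj F C n ≫ q = crossRetr (gammaBicone C n) F α := by
  refine ⟨cokernel.desc _ (crossRetr (gammaBicone C n) F α) ?_, cokernel.π_desc _ _ _⟩
  cases n with
  | zero => exact degenerate_zero_arrow_comp _ _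
  | succ n =>
    exact degenerate_succ_arrow_comp_eq_zero _ _ fun i => map_gammaσ_comp_crossRetr hF C i hα

variable (F)

/-- The canonical map from the sum of the honourable cross-effects to `NFΓ(C)_n`. -/
noncomputable def canonicalMap (n : ℕ) (C : ChainComplex A ℕ) :
    (honourableSum F n).obj C ⟶ ((doldPuppe F).obj C).X n :=
  biproduct.desc fun α : {α : Finset (Sur n) // Honourable α} =>
    crossIncl (gammaBicone C n) F α.1 ≫ gammaProj F C n

theorem honourableSumι_comp_canonicalMap {n : ℕ} (α : Finset (Sur n)) (hα : Honourable α)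
    (C : ChainComplex A ℕ) :
    honourableSumι F α hα C ≫ canonicalMap F n C =
      crossIncl (gammaBicone C n) F α ≫ gammaProj F C n :=
  biproduct.ι_desc _ _

theorem crossIncl_comp_gammaProj {n : ℕ} (α : Finset (Sur n)) (C : ChainComplex A ℕ) :
    crossIncl (gammaBicone C n) F α ≫ gammaProj F C n =
      crossEffectι F ((tuple α).obj C) ≫ F.map (subsumι α C) ≫ doldPuppeProj F n C :=
  Category.assoc _ _ _

/-- The inverse has the components `NFΓ(C)_n → cr(F)` induced by the retractions `crossRetr`. -/
theorem isIso_canonicalMap (hF : ∀ Z : A, IsZero Z → IsZero (F.obj Z)) (n : ℕ)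
    (C : ChainComplex A ℕ) : IsIso (canonicalMap F n C) := by
  classical
  choose q hq using fun α : {α : Finset (Sur n) // Honourable α} =>
    exists_gammaProj_comp_eq_crossRetr hF C α.2
  change IsIso (biproduct.desc fun α : {α : Finset (Sur n) // Honourable α} =>
    crossIncl (gammaBicone C n) F α.1 ≫ gammaProj F C n)
  refine ⟨biproduct.lift q, biproduct.hom_ext' _ _ fun α => biproduct.hom_ext _ _ fun β => ?_, ?_⟩
  · rw [biproduct.ι_desc_assoc, Category.assoc, Category.assoc, biproduct.lift_π, hq,
      crossIncl_comp_crossRetr _ hF, Category.comp_id, biproduct.ι_π]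
    simp only [Subtype.ext_iff]
  · rw [← cancel_epi (gammaProj F C n), biproduct.lift_desc, Preadditive.comp_sum,
      Category.comp_id]
    convert sum_honourable_crossIdem_comp_gammaProj F C n using 1
    refine Finset.sum_congr rfl fun α _ => ?_
    rw [← Category.assoc, hq, ← Category.assoc, crossRetr_comp_crossIncl_gamma hF]

/-- The map `Γ(f)_n`, between the apices of the decompositions. -/
noncomputable def gammaMap {C D : ChainComplex A ℕ} (f : C ⟶ D) (n : ℕ) :
    (gammaBicone C n).pt ⟶ (gammaBicone D n).pt :=
  (AlgebraicTopology.DoldKan.Γ₀.map f).app (op (SimplexCategory.mk n))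

/-- The two descriptions of the inclusion of a summand in `Γ(C)_n` agree: `Γ₀.map` is defined by the
one from the splitting. -/
theorem splitting_cofan_inj (C : ChainComplex A ℕ) {n : ℕ} (μ : Sur n) :
    ((AlgebraicTopology.DoldKan.Γ₀.splitting C).cofan (op (SimplexCategory.mk n))).inj μ =
      (gammaBicone C n).ι μ := by
  let i : μ.1.unop ⟶ (SimplicialObject.Splitting.IndexSet.id μ.1).1.unop := 𝟙 μ.1.unop
  have : Mono i := inferInstanceAs (Mono (𝟙 μ.1.unop))
  refine (AlgebraicTopology.DoldKan.Γ₀.Obj.map_on_summand₀ C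
    (SimplicialObject.Splitting.IndexSet.id μ.1)
    (Δ' := op (SimplexCategory.mk n)) (θ := μ.e.op) (e := μ.e) (i := i) rfl).trans ?_
  exact (congrArg (· ≫ _)
    (AlgebraicTopology.DoldKan.Γ₀.Obj.Termwise.mapMono_id C μ.1.unop)).trans (Category.id_comp _)

theorem gammaBicone_ι_comp_gammaMap {C D : ChainComplex A ℕ} (f : C ⟶ D) {n : ℕ} (μ : Sur n) :
    (gammaBicone C n).ι μ ≫ gammaMap f n = f.f μ.target ≫ (gammaBicone D n).ι μ := by
  rw [← splitting_cofan_inj, ← splitting_cofan_inj]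
  exact (AlgebraicTopology.DoldKan.Γ₀.splitting C).ι_desc _ _ μ

theorem subsumIncl_comp_gammaMap {n : ℕ} (α : Finset (Sur n)) {C D : ChainComplex A ℕ}
    (f : C ⟶ D) :
    subsumIncl (gammaBicone C n) α ≫ gammaMap f n =
      biproduct.map (fun μ : α => f.f μ.1.target) ≫ subsumIncl (gammaBicone D n) α := by
  refine biproduct.hom_ext' _ _ fun μ => ?_
  rw [subsumIncl, subsumIncl, biproduct.ι_map_assoc, biproduct.ι_desc_assoc, biproduct.ι_desc,
    gammaBicone_ι_comp_gammaMap]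

theorem gammaProj_comp_doldPuppe_map {C D : ChainComplex A ℕ} (f : C ⟶ D) (n : ℕ) :
    gammaProj F C n ≫ ((doldPuppe F).map f).f n = F.map (gammaMap f n) ≫ gammaProj F D n :=
  normalizedProj_comp_normalizedMap (((SimplicialObject.whiskering A B).obj F).map
    (AlgebraicTopology.DoldKan.Γ₀.map f)) n

theorem crossEffect_map_comp_crossIncl {n : ℕ} (α : Finset (Sur n)) {C D : ChainComplex A ℕ}
    (f : C ⟶ D) :
    (crossEffect F α).map ((tuple α).map f) ≫ crossIncl (gammaBicone D n) F α =
      crossIncl (gammaBicone C n) F α ≫ F.map (gammaMap f n) := by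
  have h : (crossEffect F α).map ((tuple α).map f) ≫
      crossEffectι F (fun μ : α => D.X μ.1.target) =
        crossEffectι F (fun μ : α => C.X μ.1.target) ≫
          F.map (biproduct.map (fun μ : α => f.f μ.1.target)) :=
    crossEffectMap_ι F ((tuple α).map f)
  rw [crossIncl, crossIncl, Category.assoc, ← F.map_comp, subsumIncl_comp_gammaMap, F.map_comp]
  exact (Category.assoc _ _ _).symm.trans ((congrArg (· ≫ _) h).trans (Category.assoc _ _ _))

/-- The canonical map, as a natural transformation. -/
noncomputable def canonicalTrans (n : ℕ) :
    honourableSum F n ⟶ doldPuppe F ⋙ HomologicalComplex.eval B _ n where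
  app C := canonicalMap F n C
  naturality C D f := by
    refine biproduct.hom_ext' _ _ fun α => ?_
    have h : (crossEffect F α.1).map ((tuple α.1).map f) ≫
        honourableSumι F α.1 α.2 D ≫ canonicalMap F n D =
          honourableSumι F α.1 α.2 C ≫ canonicalMap F n C ≫ ((doldPuppe F).map f).f n := by
      refine (congrArg (_ ≫ ·) (honourableSumι_comp_canonicalMap F α.1 α.2 D)).trans ?_
      refine (Category.assoc _ _ _).symm.trans ?_
      refine (congrArg (· ≫ _) (crossEffect_map_comp_crossIncl F α.1 f)).trans ?_
      refine (Category.assoc _ _ _).trans ?_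
      refine (congrArg (_ ≫ ·) (gammaProj_comp_doldPuppe_map F f n).symm).trans ?_
      refine (Category.assoc _ _ _).symm.trans ?_
      refine (congrArg (· ≫ _) (honourableSumι_comp_canonicalMap F α.1 α.2 C).symm).trans ?_
      exact Category.assoc _ _ _
    exact (biproduct.ι_map_assoc (fun α : {α : Finset (Sur n) // Honourable α} =>
      (crossEffect F α.1).map ((tuple α.1).map f)) α (canonicalMap F n D)).trans h

end Gamma

end DoldPuppe

theorem mainTheorem1 {A : Type*} [Category* A] [Preadditive A]
    [HasFiniteBiproducts A] {B : Type*} [Category* B] [Abelian B] (F : A ⥤ B)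
    (hF : ∀ Z : A, IsZero Z → IsZero (F.obj Z)) (n : ℕ) :
    ∃ e : DoldPuppe.doldPuppe F ⋙ HomologicalComplex.eval B _ n ≅ DoldPuppe.honourableSum F n,
      ∀ (C : ChainComplex A ℕ) (α : Finset (DoldPuppe.Sur n)) (hα : DoldPuppe.Honourable α),
        DoldPuppe.honourableSumι F α hα C ≫ e.inv.app C =
          DoldPuppe.crossEffectι F ((DoldPuppe.tuple α).obj C) ≫
            F.map (DoldPuppe.subsumι α C) ≫ DoldPuppe.doldPuppeProj F n C := by
  have (C : ChainComplex A ℕ) : IsIso ((DoldPuppe.canonicalTrans F n).app C) :=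
    DoldPuppe.isIso_canonicalMap F hF n C
  have : IsIso (DoldPuppe.canonicalTrans F n) := NatIso.isIso_of_isIso_app _
  exact ⟨(asIso (DoldPuppe.canonicalTrans F n)).symm, fun C α hα =>
    (DoldPuppe.honourableSumι_comp_canonicalMap F α hα C).trans
      (DoldPuppe.crossIncl_comp_gammaProj F α C)⟩
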